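/- Let $n\ge 0$, $N=\mathbb{Z}^n$ and $M=\mathrm{Hom}(N,\mathbb{Z})$. Let $\Sigma$ be a (finite, non-empty) rational fan of strongly convex polyhedral cones in $N_{\mathbb{R}}=\mathbb{R}^n$, and let $X_\Sigma$ be the associated complex toric variety, obtained by gluing the affine varieties $U_\sigma=\mathrm{Spec}\,\mathbb{C}[\sigma^\vee\cap M]$, $\sigma\in\Sigma$, along the faces of the cones; its points are considered with the classical topology, and $(\mathbb{C}^*)^n=U_{\{0\}}\subseteq X_\Sigma$. For a positive integer $m$ let $\Phi_m:(\mathbb{C}^*)^n\to(\mathbb{C}^*)^n$, $(z_1,\dots,z_n)\mapsto(z_1^m,\dots,z_n^m)$, and denote also by $\Phi_m:X_\Sigma\to X_\Sigma$ the toric endomorphism extending it, induced by $v\mapsto mv$ on $N$; identifying the points of $U_\sigma$ with the semigroup homomorphisms $\gamma:\sigma^\vee\cap M\to(\mathbb{C},\cdot)$, it is given on $U_\sigma$ by $\gamma\mapsto\gamma^m$. Let $Z\subseteq(\mathbb{C}^*)^n$ be a (closed algebraic, not necessarily irreducible) subvariety, that is, the set of common zeros of a collection of Laurent polynomials, and let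 $\overline{Z}$ be the closure of $Z$ in $X_\Sigma$. Then $$\Phi_m^{-1}(\overline{Z})=\overline{\Phi_m^{-1}(Z)},$$ where the closure on the right-hand side is also taken in $X_\Sigma$. -/

import Mathlib

noncomputable section

namespace Toric

/-- The character lattice `M = ℤⁿ`, dual to the lattice `N = ℤⁿ` through the dot product. -/
abbrev M (n : ℕ) : Type := Fin n → ℤ

/-- The real vector space `N_ℝ = ℝⁿ`. -/
abbrev NR (n : ℕ) : Type := Fin n → ℝ

/-- The complex torus `T_N = (ℂ^*)ⁿ`, with coordinatewise multiplication. -/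
abbrev Torus (n : ℕ) : Type := Fin n → ℂˣ

/-- The duality pairing `⟨u, v⟩` of `u ∈ M` with `v ∈ N_ℝ`. -/
def pairing {n : ℕ} (u : M n) (v : NR n) : ℝ := ∑ i, (u i : ℝ) * v i

/-- Rational polyhedral cones: cones generated by finitely many lattice vectors. -/
def IsRationalPolyhedral {n : ℕ} (σ : PointedCone ℝ (NR n)) : Prop :=
  ∃ s : Finset (Fin n → ℤ),
    σ = PointedCone.hull ℝ ((fun (w : Fin n → ℤ) (i : Fin n) => (w i : ℝ)) '' (s : Set (Fin n → ℤ)))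

/-- A rational fan in `N_ℝ`: a finite nonempty collection of strongly convex rational polyhedral
cones which contains every face of each of its cones, and in which any two cones meet in a common
face. -/
structure Fan (n : ℕ) where
  cones : Set (PointedCone ℝ (NR n))
  finite : cones.Finite
  nonempty : cones.Nonempty
  rational : ∀ σ ∈ cones, IsRationalPolyhedral σ
  stronglyConvex : ∀ σ ∈ cones, ∀ v ∈ σ, -v ∈ σ → v = 0
  face_mem : ∀ σ ∈ cones, ∀ τ : PointedCone ℝ (NR n), τ.IsFaceOf σ → τ ∈ cones
  inter_face : ∀ σ ∈ cones, ∀ τ ∈ cones, (σ ⊓ τ).IsFaceOf σ ∧ (σ ⊓ τ).IsFaceOf τ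

/-- The zero cone belongs to every fan. -/
theorem Fan.bot_mem {n : ℕ} (F : Fan n) : (⊥ : PointedCone ℝ (NR n)) ∈ F.cones := by
  obtain ⟨σ, hσ⟩ := F.nonempty
  refine F.face_mem σ hσ ⊥ ⟨bot_le, ?_⟩
  intro x y a hx hy ha hxy
  rw [Submodule.mem_bot] at hxy ⊢
  refine F.stronglyConvex σ hσ x hx ?_
  have hxe : -x = a⁻¹ • y := by
    have h1 : y = -(a • x) := (neg_eq_of_add_eq_zero_right hxy).symm
    rw [h1, smul_neg, smul_smul, inv_mul_cancel₀ ha.ne', one_smul]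
  rw [hxe]
  exact σ.smul_mem (inv_pos.mpr ha).le hy

/-- The semigroup `σ^∨ ∩ M`. -/
def dualMonoid {n : ℕ} (σ : PointedCone ℝ (NR n)) : AddSubmonoid (M n) where
  carrier := {u | ∀ v ∈ σ, 0 ≤ pairing u v}
  zero_mem' := by
    intro v _
    simp [pairing]
  add_mem' := by
    intro a b ha hb v hv
    have h : pairing (a + b) v = pairing a v + pairing b v := by
      simp [pairing, add_mul, Finset.sum_add_distrib]
    rw [h]
    exact add_nonneg (ha v hv) (hb v hv)

theorem dualMonoid_anti {n : ℕ} {τ σ : PointedCone ℝ (NR n)} (h : τ ≤ σ) :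
    dualMonoid σ ≤ dualMonoid τ :=
  fun _ hu v hv => hu v (h hv)

/-- The complex points of the affine toric variety `U_σ = Spec ℂ[σ^∨ ∩ M]`: semigroup
homomorphisms (of semigroups with unit) from `σ^∨ ∩ M` to `(ℂ, ·)`. -/
abbrev Chart {n : ℕ} (σ : PointedCone ℝ (NR n)) : Type :=
  Multiplicative (dualMonoid σ) →* ℂ

/-- The classical topology of `U_σ`: the coarsest one for which every character
`γ ↦ γ(u)`, `u ∈ σ^∨ ∩ M`, is continuous as a function to `ℂ`. -/
instance {n : ℕ} (σ : PointedCone ℝ (NR n)) : TopologicalSpace (Chart σ) :=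
  TopologicalSpace.induced
    (fun (γ : Chart σ) (u : Multiplicative (dualMonoid σ)) => γ u)
    inferInstance

/-- For `τ ≤ σ` the map `U_τ → U_σ` restricting `γ` from `τ^∨ ∩ M` to `σ^∨ ∩ M`; when `τ` is
a face of `σ` this is the open immersion used for gluing. -/
def Chart.incl {n : ℕ} {τ σ : PointedCone ℝ (NR n)} (h : τ ≤ σ) (γ : Chart τ) : Chart σ :=
  γ.comp
    (AddMonoidHom.toMultiplicative (AddSubmonoid.inclusion (dualMonoid_anti h)))

/-- The map `U_σ → U_σ` given by `γ ↦ γ ∘ φ_m`, where `φ_m` is multiplication by `m` on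
`σ^∨ ∩ M`. -/
def Chart.mulMap {n : ℕ} {σ : PointedCone ℝ (NR n)} (m : ℕ) (γ : Chart σ) : Chart σ :=
  γ.comp
    (powMonoidHom m : Multiplicative (dualMonoid σ) →* Multiplicative (dualMonoid σ))

/-- The gluing relation: a point of `U_τ` is identified with its image in `U_σ` whenever `τ` is a
face of `σ`. -/
def GlueRel {n : ℕ} (F : Fan n) (p q : Σ σ : F.cones, Chart σ.1) : Prop :=
  ∃ h : (p.1.1).IsFaceOf q.1.1, q.2 = Chart.incl h.le p.2

/-- The toric variety `X_Σ` (its complex points, with the classical topology), obtained by gluing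
the affine toric varieties `U_σ`, `σ ∈ Σ`, along the faces of the cones. -/
def ToricVariety {n : ℕ} (F : Fan n) : Type := Quot (GlueRel F)

/-- The quotient topology of the disjoint union of the `U_σ`. -/
instance {n : ℕ} (F : Fan n) : TopologicalSpace (ToricVariety F) :=
  inferInstanceAs (TopologicalSpace (Quot (GlueRel F)))

/-- The toric endomorphism `Φ_m : X_Σ → X_Σ` induced by multiplication by `m` on `N`. -/
def toricPower {n : ℕ} (F : Fan n) (m : ℕ) : ToricVariety F → ToricVariety F :=
  Quot.map (fun p => ⟨p.1, Chart.mulMap m p.2⟩) (by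
    rintro ⟨τ, γ⟩ ⟨σ, δ⟩ ⟨h, hδ⟩
    refine ⟨h, ?_⟩
    have hδ' : δ = Chart.incl h.le γ := hδ
    change Chart.mulMap m δ = Chart.incl h.le (Chart.mulMap m γ)
    rw [hδ']
    refine MonoidHom.ext fun u => ?_
    simp [Chart.mulMap, Chart.incl])

/-- The character evaluation `u ↦ t^u = t_1^{u_1} ⋯ t_n^{u_n}` at a point `t` of the torus. -/
def character {n : ℕ} (t : Torus n) : Multiplicative (M n) →* ℂ where
  toFun u := ∏ i, ((t i ^ (Multiplicative.toAdd u i) : ℂˣ) : ℂ)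
  map_one' := by simp
  map_mul' u v := by simp [zpow_add, Finset.prod_mul_distrib]

/-- The embedding of `(ℂ^*)ⁿ` into `X_Σ` as the chart `U_{0}`. -/
def torusEmbedding {n : ℕ} (F : Fan n) (t : Torus n) : ToricVariety F :=
  Quot.mk (GlueRel F) ⟨⟨⊥, F.bot_mem⟩,
    (character t).comp (AddMonoidHom.toMultiplicative (dualMonoid ⊥).subtype)⟩

/-- The map `Φ_m : (ℂ^*)ⁿ → (ℂ^*)ⁿ`, `(z_1, …, z_n) ↦ (z_1^m, …, z_n^m)`. -/
def torusPower {n : ℕ} (m : ℕ) (t : Torus n) : Torus n := fun i => t i ^ m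

/-- The value at `t ∈ (ℂ^*)ⁿ` of a Laurent polynomial in `n` variables, that is, of an element of
the group algebra `ℂ[M]`. -/
def laurentEval {n : ℕ} (t : Torus n) (f : AddMonoidAlgebra ℂ (M n)) : ℂ :=
  AddMonoidAlgebra.lift ℂ ℂ (M n) (character t) f

/-- A (closed, possibly reducible) algebraic subvariety of `(ℂ^*)ⁿ`: the set of common zeros of a
collection of Laurent polynomials. -/
def IsSubvariety {n : ℕ} (Z : Set (Torus n)) : Prop :=
  ∃ I : Set (AddMonoidAlgebra ℂ (M n)), Z = {t | ∀ f ∈ I, laurentEval t f = 0}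

end Toric

end

namespace Toric

open Multiplicative Topology

/-! The map `toricPower` is closed, and the `m`-torsion of the torus acts transitively on its
fibres. By closedness, the image of the right-hand closure is a closed set containing `Z`, hence
contains the closure of `Z`. A point lying over that closure is thus a torsion translate of a point
of the right-hand closure, and such translations preserve the preimage of `Z`. The other inclusion
is continuity.

Both facts are proved on charts (`Chart.isProperMap_mulMap`, `Chart.exists_torusMul_of_mulMap_eq`)
and pass to `X_Σ` by `exists_chartMap_of_toricPower_eq`. The algebraic input is that the support of
a point of `U_σ` is saturated, so the group it generates is a direct summand of `M` and
homomorphisms on it extend to `M`. -/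

/-! ### Extending homomorphisms to the character lattice -/

/-- A homomorphism from a saturated submonoid of `ℤⁿ` to an abelian group extends to `ℤⁿ`. -/
theorem exists_addMonoidHom_extension {n : ℕ} {A : Type*} [AddCommGroup A]
    (P : AddSubmonoid (M n)) (hP : ∀ (k : ℕ) (u : M n), 0 < k → k • u ∈ P → u ∈ P)
    (f : P →+ A) : ∃ φ : M n →+ A, ∀ u : P, φ u = f u := by
  let H : AddSubgroup (M n) :=
    { carrier := {u | ∃ a b : P, u = a - b}
      zero_mem' := ⟨0, 0, by simp⟩
      add_mem' := by
        rintro _ _ ⟨a, b, rfl⟩ ⟨c, d, rfl⟩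
        exact ⟨a + c, b + d, by push_cast; abel⟩
      neg_mem' := by
        rintro _ ⟨a, b, rfl⟩
        exact ⟨b, a, by abel⟩ }
  have hH : ∀ h : H, ∃ a b : P, (h : M n) = a - b := fun h => h.2
  choose a b hab using hH
  -- The value does not depend on the chosen difference, so `f` extends to the group `H` generated
  -- by `P`.
  have key : ∀ (h : H) (c d : P), (h : M n) = c - d → f (a h) - f (b h) = f c - f d := by
    intro h c d hcd
    have : a h + d = c + b h := by
      apply Subtype.ext
      have h1 := hab h
      rw [hcd] at h1
      push_cast
      linear_combination (exp := 1) -h1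
    have h2 := congrArg f this
    rw [map_add, map_add] at h2
    rw [sub_eq_sub_iff_add_eq_add, h2]
  let g : H →+ A := AddMonoidHom.mk' (fun h => f (a h) - f (b h)) (by
    intro x y
    rw [key (x + y) (a x + a y) (b x + b y) (by
      push_cast; rw [hab x, hab y]; abel), map_add, map_add]
    abel)
  let H' : Submodule ℤ (M n) := AddSubgroup.toIntSubmodule H
  have htf : Module.IsTorsionFree ℤ (M n ⧸ H') := by
    have hnat : ∀ (k : ℕ) (u : M n), 0 < k → k • u ∈ H → u ∈ H := by
      rintro k u hk ⟨c, d, hcd⟩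
      obtain ⟨k, rfl⟩ := Nat.exists_eq_succ_of_ne_zero hk.ne'
      -- With `k + 1` for the old `k`: `(k + 1)(u + d) = c + k d` lies in `P`, so saturation
      -- applies.
      have h1 : u + d ∈ P := by
        refine hP (k + 1) _ hk ?_
        have : (k + 1) • (u + (d : M n)) = ((c + k • d : P) : M n) := by
          rw [smul_add, hcd]
          push_cast
          rw [succ_nsmul]
          abel
        rw [this]
        exact Subtype.mem _
      exact ⟨⟨_, h1⟩, d, by simp⟩
    refine Module.IsTorsionFree.of_smul_eq_zero fun r x hx => ?_
    obtain ⟨u, rfl⟩ := H'.mkQ_surjective x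
    by_cases hr : r = 0
    · exact Or.inl hr
    refine Or.inr ?_
    rw [← map_smul, Submodule.mkQ_apply, Submodule.Quotient.mk_eq_zero] at hx
    rw [Submodule.mkQ_apply, Submodule.Quotient.mk_eq_zero]
    refine hnat r.natAbs u (Int.natAbs_pos.mpr hr) ?_
    have hx' : r • u ∈ H := hx
    rw [← natCast_zsmul]
    rcases abs_choice r with h | h <;> rw [Int.natCast_natAbs, h]
    · exact hx'
    · rw [neg_smul]
      exact H.neg_mem hx'
  -- The quotient is free, so it has a section `s`, and `u ↦ u - s [u]` retracts `M` onto `H`. No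
  -- divisibility of `A` is needed, so `A` may be the group of `m`-th roots of unity.
  have : Module.Free ℤ (M n ⧸ H') := Module.free_of_finite_type_torsion_free'
  obtain ⟨s, hs⟩ := Module.projective_lifting_property H'.mkQ LinearMap.id H'.mkQ_surjective
  have hmem : ∀ u : M n, u - s (H'.mkQ u) ∈ H := by
    intro u
    change u - s (H'.mkQ u) ∈ H'
    rw [← Submodule.Quotient.mk_eq_zero, ← Submodule.mkQ_apply, map_sub]
    have := LinearMap.congr_fun hs (H'.mkQ u)
    simp only [LinearMap.comp_apply, LinearMap.id_apply] at this
    rw [this, sub_self]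
  refine ⟨g.comp (AddMonoidHom.mk' (fun u => ⟨u - s (H'.mkQ u), hmem u⟩) ?_), fun u => ?_⟩
  · intro x y
    apply Subtype.ext
    simp only [map_add]
    push_cast
    abel
  · have hu : (u : M n) ∈ H' := ⟨u, 0, by simp⟩
    have h0 : H'.mkQ (u : M n) = 0 := by
      rwa [Submodule.mkQ_apply, Submodule.Quotient.mk_eq_zero]
    change f (a _) - f (b _) = f u
    rw [key _ u 0 (by
      change (u : M n) - s (H'.mkQ u) = _
      rw [h0, map_zero]
      simp), map_zero, sub_zero]

/-- Every homomorphism from `ℤⁿ` to a subgroup of `ℂˣ` is a character evaluation. -/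
theorem exists_torus_of_addMonoidHom {n : ℕ} {A : Subgroup ℂˣ} (φ : M n →+ Additive A) :
    ∃ t : Torus n, (∀ i, t i ∈ A) ∧
      ∀ u : M n, character t (ofAdd u) = (((φ u).toMul : ℂˣ) : ℂ) := by
  refine ⟨fun i => ((φ (Pi.single i 1)).toMul : A), fun i => Subtype.mem _, fun u => ?_⟩
  have hu : φ u = ∑ i, u i • φ (Pi.single i 1) := by
    simp_rw [← map_zsmul, ← map_sum]
    congr 1
    ext j
    simp [Finset.sum_apply, Pi.single_apply]
  rw [hu]
  simp [character, toMul_sum, toMul_zsmul]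

/-! ### Supports, roots and torsion orbits in a chart -/

/-- The set of `u ∈ σ^∨ ∩ M` at which a point of `U_σ` does not vanish. -/
def Chart.support {n : ℕ} {σ : PointedCone ℝ (NR n)} (γ : Chart σ) : AddSubmonoid (M n) where
  carrier := {u | ∃ h : u ∈ dualMonoid σ, γ (ofAdd ⟨u, h⟩) ≠ 0}
  zero_mem' := ⟨zero_mem _, by
    change γ 1 ≠ 0
    simp⟩
  add_mem' := by
    rintro u v ⟨hu, hu'⟩ ⟨hv, hv'⟩
    refine ⟨add_mem hu hv, ?_⟩
    have : γ (ofAdd ⟨u + v, add_mem hu hv⟩) = γ (ofAdd ⟨u, hu⟩) * γ (ofAdd ⟨v, hv⟩) := by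
      rw [← map_mul]; rfl
    rw [this]
    exact mul_ne_zero hu' hv'

theorem mem_dualMonoid_of_nsmul_mem {n : ℕ} {σ : PointedCone ℝ (NR n)} {k : ℕ} {u : M n}
    (hk : 0 < k) (h : k • u ∈ dualMonoid σ) : u ∈ dualMonoid σ := by
  intro v hv
  have h1 : 0 ≤ pairing (k • u) v := h v hv
  have h2 : pairing (k • u) v = k * pairing u v := by
    simp [pairing, Finset.mul_sum, mul_assoc]
  rw [h2] at h1
  exact nonneg_of_mul_nonneg_right h1 (by exact_mod_cast hk)

theorem Chart.mem_support_of_nsmul_mem {n : ℕ} {σ : PointedCone ℝ (NR n)} (γ : Chart σ)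
    (k : ℕ) (u : M n) (hk : 0 < k) (h : k • u ∈ γ.support) : u ∈ γ.support := by
  obtain ⟨hu, hne⟩ := h
  have hu' := mem_dualMonoid_of_nsmul_mem hk hu
  refine ⟨hu', fun h0 => hne ?_⟩
  have : γ (ofAdd ⟨k • u, hu⟩) = γ (ofAdd ⟨u, hu'⟩) ^ k := by
    rw [← map_pow]; rfl
  rw [this, h0, zero_pow hk.ne']

/-- The restriction of a point of `U_σ` to its support, as a homomorphism to `ℂˣ`. -/
noncomputable def Chart.supportHom {n : ℕ} {σ : PointedCone ℝ (NR n)} (γ : Chart σ) :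
    γ.support →+ Additive ℂˣ :=
  AddMonoidHom.mk' (fun u => Additive.ofMul (Units.mk0 (γ (ofAdd ⟨u.1, u.2.1⟩)) u.2.2)) (by
    intro u v
    apply Additive.toMul.injective
    apply Units.ext
    change γ _ = γ _ * γ _
    rw [← map_mul]
    rfl)

/-- The action of the torus on `U_σ`. -/
noncomputable def Chart.torusMul {n : ℕ} {σ : PointedCone ℝ (NR n)} (t : Torus n) (γ : Chart σ) :
    Chart σ :=
  (character t).comp (AddMonoidHom.toMultiplicative (dualMonoid σ).subtype) * γ

theorem Chart.torusMul_apply {n : ℕ} {σ : PointedCone ℝ (NR n)} (t : Torus n) (γ : Chart σ)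
    (u : M n) (hu : u ∈ dualMonoid σ) :
    Chart.torusMul t γ (ofAdd ⟨u, hu⟩) = character t (ofAdd u) * γ (ofAdd ⟨u, hu⟩) := rfl

theorem Chart.mulMap_apply {n : ℕ} {σ : PointedCone ℝ (NR n)} (m : ℕ) (γ : Chart σ)
    (u : Multiplicative (dualMonoid σ)) : Chart.mulMap m γ u = γ u ^ m :=
  map_pow γ u m

theorem character_mul {n : ℕ} (s t : Torus n) (u : Multiplicative (M n)) :
    character (s * t) u = character s u * character t u := by
  simp [character, mul_zpow, Finset.prod_mul_distrib]

theorem character_one {n : ℕ} (u : Multiplicative (M n)) : character (1 : Torus n) u = 1 := by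
  simp [character]

theorem character_pow {n : ℕ} (t : Torus n) (m : ℕ) (u : Multiplicative (M n)) :
    character (torusPower m t) u = character t u ^ m := by
  simp only [character, torusPower, MonoidHom.coe_mk, OneHom.coe_mk, ← Finset.prod_pow]
  refine Finset.prod_congr rfl fun i _ => ?_
  push_cast
  rw [← zpow_natCast, ← zpow_natCast, ← zpow_mul, ← zpow_mul, mul_comm]

theorem torusPower_surjective {n m : ℕ} (hm : 0 < m) :
    Function.Surjective (torusPower m : Torus n → Torus n) := by
  intro t
  have h : ∀ i, ∃ z : ℂˣ, z ^ m = t i := by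
    intro i
    obtain ⟨z, hz⟩ := IsAlgClosed.exists_pow_nat_eq ((t i : ℂˣ) : ℂ) hm
    have hz0 : z ≠ 0 := by
      rintro rfl
      rw [zero_pow hm.ne'] at hz
      exact (t i).ne_zero hz.symm
    exact ⟨Units.mk0 z hz0, Units.ext (by simpa using hz)⟩
  choose z hz using h
  exact ⟨z, funext hz⟩

/-- The map `γ ↦ γ^m` of `U_σ` is surjective. -/
theorem Chart.mulMap_surjective {n : ℕ} {σ : PointedCone ℝ (NR n)} {m : ℕ} (hm : 0 < m) :
    Function.Surjective (Chart.mulMap m : Chart σ → Chart σ) := by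
  classical
  intro δ
  obtain ⟨φ, hφ⟩ := exists_addMonoidHom_extension δ.support δ.mem_support_of_nsmul_mem
    ((MonoidHom.toAdditive (Subgroup.topEquiv (G := ℂˣ)).symm.toMonoidHom).comp δ.supportHom)
  obtain ⟨t, -, ht⟩ := exists_torus_of_addMonoidHom φ
  obtain ⟨s, rfl⟩ := torusPower_surjective hm t
  have hs : ∀ (u : M n) (hu : u ∈ dualMonoid σ), δ (ofAdd ⟨u, hu⟩) ≠ 0 →
      character s (ofAdd u) ^ m = δ (ofAdd ⟨u, hu⟩) := by
    intro u hu hne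
    rw [← character_pow, ht, hφ ⟨u, hu, hne⟩]
    rfl
  -- Extension by zero off the support of `δ`; it is multiplicative because a product in `ℂ`
  -- vanishes only if a factor does.
  let γ : Chart σ :=
    { toFun := fun u => if δ u = 0 then 0 else character s (ofAdd ((toAdd u : dualMonoid σ) : M n))
      map_one' := by
        rw [map_one, if_neg one_ne_zero]
        exact map_one (character s)
      map_mul' := by
        intro u v
        rw [map_mul]
        by_cases hu : δ u = 0
        · simp [hu]
        by_cases hv : δ v = 0
        · simp [hv]
        rw [if_neg hu, if_neg hv, if_neg (mul_ne_zero hu hv), ← map_mul]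
        rfl }
  refine ⟨γ, MonoidHom.ext fun u => ?_⟩
  rw [Chart.mulMap_apply]
  change (if δ u = 0 then 0 else character s (ofAdd ((toAdd u : dualMonoid σ) : M n))) ^ m = δ u
  split_ifs with h
  · rw [h, zero_pow hm.ne']
  · exact hs _ _ h

/-- The fibres of `γ ↦ γ^m` are orbits of the `m`-torsion of the torus. -/
theorem Chart.exists_torusMul_of_mulMap_eq {n : ℕ} {σ : PointedCone ℝ (NR n)} {m : ℕ}
    (hm : 0 < m) {γ γ' : Chart σ} (h : Chart.mulMap m γ = Chart.mulMap m γ') :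
    ∃ t : Torus n, torusPower m t = 1 ∧ Chart.torusMul t γ = γ' := by
  have hpow : ∀ u, γ u ^ m = γ' u ^ m := fun u => by
    rw [← Chart.mulMap_apply, ← Chart.mulMap_apply, h]
  have hzero : ∀ u, γ u = 0 ↔ γ' u = 0 := fun u => by
    rw [← pow_eq_zero_iff hm.ne', hpow, pow_eq_zero_iff hm.ne']
  have hle : γ.support ≤ γ'.support := fun u ⟨hu, hne⟩ => ⟨hu, fun h0 => hne ((hzero _).mpr h0)⟩
  -- The quotient `γ' / γ` on the common support, written additively; its values are `m`-th roots of
  -- unity.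
  let f : γ.support →+ Additive ℂˣ := γ'.supportHom.comp (AddSubmonoid.inclusion hle) -
    γ.supportHom
  have hf : ∀ u, (f u).toMul ∈ rootsOfUnity m ℂ := by
    intro u
    rw [mem_rootsOfUnity]
    have : (f u).toMul = Units.mk0 _ (hle u.2).2 / Units.mk0 _ u.2.2 := rfl
    rw [this, div_pow, div_eq_one]
    exact Units.ext (hpow _).symm
  let g : γ.support →+ Additive (rootsOfUnity m ℂ) :=
    AddMonoidHom.mk' (fun u => Additive.ofMul ⟨(f u).toMul, hf u⟩) (fun u v => by
      apply Additive.toMul.injective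
      apply Subtype.ext
      change (f (u + v)).toMul = (f u).toMul * (f v).toMul
      rw [map_add]
      rfl)
  obtain ⟨φ, hφ⟩ := exists_addMonoidHom_extension γ.support γ.mem_support_of_nsmul_mem g
  obtain ⟨t, htm, ht⟩ := exists_torus_of_addMonoidHom φ
  refine ⟨t, funext fun i => (mem_rootsOfUnity m _).mp (htm i), MonoidHom.ext fun u => ?_⟩
  obtain ⟨u, hu⟩ := u
  change Chart.torusMul t γ (ofAdd ⟨u, hu⟩) = γ' (ofAdd ⟨u, hu⟩)
  rw [Chart.torusMul_apply]
  by_cases h0 : γ (ofAdd ⟨u, hu⟩) = 0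
  · rw [h0, mul_zero, (hzero _).mp h0]
  · rw [ht, hφ ⟨u, hu, h0⟩]
    have : (((g ⟨u, hu, h0⟩).toMul : ℂˣ) : ℂ) =
        γ' (ofAdd ⟨u, hu⟩) / γ (ofAdd ⟨u, hu⟩) := by
      change ((Units.mk0 (γ' (ofAdd ⟨u, hu⟩)) (hle ⟨hu, h0⟩).2 / Units.mk0 (γ (ofAdd ⟨u, hu⟩)) h0 : ℂˣ) : ℂ) = _
      rw [Units.val_div_eq_div_val]
      rfl
    rw [this, div_mul_cancel₀ _ h0]

theorem Chart.mulMap_incl {n : ℕ} {τ σ : PointedCone ℝ (NR n)} (h : τ ≤ σ) (m : ℕ)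
    (γ : Chart τ) :
    Chart.mulMap m (Chart.incl h γ) = Chart.incl h (Chart.mulMap m γ) :=
  MonoidHom.ext fun u => by
    rw [Chart.mulMap_apply]
    exact (Chart.mulMap_apply m γ _).symm

theorem Chart.mulMap_torusMul {n : ℕ} {σ : PointedCone ℝ (NR n)} {m : ℕ} {t : Torus n}
    (ht : torusPower m t = 1) (γ : Chart σ) :
    Chart.mulMap m (Chart.torusMul t γ) = Chart.mulMap m γ := by
  refine MonoidHom.ext fun u => ?_
  rw [Chart.mulMap_apply, Chart.mulMap_apply]
  change (character t (ofAdd ((toAdd u : dualMonoid σ) : M n)) * γ u) ^ m = _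
  rw [mul_pow, ← character_pow, ht, character_one, one_mul]

/-! ### Topology of the charts -/

theorem Chart.isClosedEmbedding_coe {n : ℕ} (σ : PointedCone ℝ (NR n)) :
    IsClosedEmbedding (fun (γ : Chart σ) (u : Multiplicative (dualMonoid σ)) => γ u) := by
  refine ⟨⟨⟨rfl⟩, DFunLike.coe_injective⟩, ?_⟩
  have : Set.range (fun (γ : Chart σ) (u : Multiplicative (dualMonoid σ)) => γ u) =
      {f | f 1 = 1} ∩ ⋂ u, ⋂ v, {f | f (u * v) = f u * f v} := by
    ext f
    simp only [Set.mem_range, Set.mem_inter_iff, Set.mem_iInter, Set.mem_ofPred_eq]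
    constructor
    · rintro ⟨γ, rfl⟩
      exact ⟨map_one γ, map_mul γ⟩
    · rintro ⟨h1, h2⟩
      exact ⟨⟨⟨f, h1⟩, h2⟩, rfl⟩
  rw [this]
  refine IsClosed.inter (isClosed_eq (continuous_apply _) continuous_const) ?_
  exact isClosed_iInter fun u => isClosed_iInter fun v =>
    isClosed_eq (continuous_apply _) ((continuous_apply u).mul (continuous_apply v))

theorem isProperMap_pow {m : ℕ} (hm : 0 < m) : IsProperMap (fun z : ℂ => z ^ m) := by
  rw [isProperMap_iff_tendsto_cocompact]
  refine ⟨continuous_pow m, ?_⟩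
  rw [← Metric.cobounded_eq_cocompact, ← tendsto_norm_atTop_iff_cobounded]
  simp_rw [norm_pow]
  exact (Filter.tendsto_pow_atTop hm.ne').comp tendsto_norm_cobounded_atTop

/-- The map `γ ↦ γ^m` of `U_σ` is proper. -/
theorem Chart.isProperMap_mulMap {n : ℕ} (σ : PointedCone ℝ (NR n)) {m : ℕ} (hm : 0 < m) :
    IsProperMap (Chart.mulMap m : Chart σ → Chart σ) := by
  have he := Chart.isClosedEmbedding_coe σ
  have hcomm : (fun (γ : Chart σ) (u : Multiplicative (dualMonoid σ)) => γ u) ∘ Chart.mulMap m =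
      (fun (f : Multiplicative (dualMonoid σ) → ℂ) u => f u ^ m) ∘ fun γ u => γ u := by
    funext γ u
    exact Chart.mulMap_apply m γ u
  have hp : IsProperMap ((fun (f : Multiplicative (dualMonoid σ) → ℂ) u => f u ^ m) ∘
      fun (γ : Chart σ) u => γ u) :=
    -- A product of proper maps is proper, even over the infinite index set `σ^∨ ∩ M`.
    (IsProperMap.pi_map fun _ => isProperMap_pow hm).comp he.isProperMap
  rw [← hcomm] at hp
  exact isProperMap_of_comp_of_inj (he.isInducing.continuous_iff.mpr hp.continuous)
    he.continuous hp he.injective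

theorem Chart.continuous_torusMul {n : ℕ} {σ : PointedCone ℝ (NR n)} (t : Torus n) :
    Continuous (Chart.torusMul t : Chart σ → Chart σ) := by
  have he := Chart.isClosedEmbedding_coe σ
  rw [he.isInducing.continuous_iff]
  exact continuous_pi fun u => continuous_const.mul ((continuous_apply u).comp he.continuous)

/-! ### Gluing: the power map on the toric variety -/

/-- The inclusion of the chart `U_σ` into `X_Σ`. -/
def chartMap {n : ℕ} (F : Fan n) (σ : F.cones) (γ : Chart σ.1) : ToricVariety F :=
  Quot.mk (GlueRel F) ⟨σ, γ⟩

theorem continuous_chartMap {n : ℕ} (F : Fan n) (σ : F.cones) : Continuous (chartMap F σ) :=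
  continuous_quot_mk.comp continuous_sigmaMk

theorem continuous_toricVariety_iff {n : ℕ} {F : Fan n} {Y : Type*} [TopologicalSpace Y]
    {f : ToricVariety F → Y} : Continuous f ↔ ∀ σ, Continuous (f ∘ chartMap F σ) := by
  refine ⟨fun h σ => h.comp (continuous_chartMap F σ), fun h => ?_⟩
  exact isQuotientMap_quot_mk.continuous_iff.mpr (continuous_sigma h)

theorem isClosed_toricVariety_iff {n : ℕ} {F : Fan n} {C : Set (ToricVariety F)} :
    IsClosed C ↔ ∀ σ, IsClosed (chartMap F σ ⁻¹' C) := by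
  refine ⟨fun h σ => h.preimage (continuous_chartMap F σ), fun h => ?_⟩
  exact isQuotientMap_quot_mk.isClosed_preimage.mp (isClosed_sigma_iff.mpr h)

theorem continuous_toricPower {n : ℕ} (F : Fan n) {m : ℕ} (hm : 0 < m) :
    Continuous (toricPower F m) :=
  continuous_toricVariety_iff.mpr fun σ =>
    (continuous_chartMap F σ).comp (Chart.isProperMap_mulMap σ.1 hm).continuous

theorem toricPower_torusEmbedding {n : ℕ} (F : Fan n) (m : ℕ) (t : Torus n) :
    toricPower F m (torusEmbedding F t) = torusEmbedding F (torusPower m t) := by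
  refine congrArg (chartMap F ⟨⊥, F.bot_mem⟩) (MonoidHom.ext fun u => ?_)
  rw [Chart.mulMap_apply]
  exact (character_pow t m _).symm

/-- The action of the torus on `X_Σ`. -/
noncomputable def toricMul {n : ℕ} (F : Fan n) (t : Torus n) : ToricVariety F → ToricVariety F :=
  Quot.map (fun p => ⟨p.1, Chart.torusMul t p.2⟩) (by
    rintro ⟨τ, γ⟩ ⟨σ, δ⟩ ⟨h, hδ⟩
    exact ⟨h, congrArg (Chart.torusMul t) hδ⟩)

theorem continuous_toricMul {n : ℕ} (F : Fan n) (t : Torus n) : Continuous (toricMul F t) :=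
  continuous_toricVariety_iff.mpr fun σ =>
    (continuous_chartMap F σ).comp (Chart.continuous_torusMul t)

theorem toricMul_torusEmbedding {n : ℕ} (F : Fan n) (s t : Torus n) :
    toricMul F s (torusEmbedding F t) = torusEmbedding F (s * t) :=
  congrArg (chartMap F ⟨⊥, F.bot_mem⟩) (MonoidHom.ext fun _ => (character_mul s t _).symm)

/-- Preimages under `Φ_m` of points of a chart lie in that chart. -/
theorem exists_chartMap_of_toricPower_eq {n : ℕ} {F : Fan n} {m : ℕ} (hm : 0 < m)
    {x : ToricVariety F} {τ : F.cones} {δ : Chart τ.1}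
    (h : toricPower F m x = chartMap F τ δ) :
    ∃ γ : Chart τ.1, chartMap F τ γ = x ∧ Chart.mulMap m γ = δ := by
  have key : ∀ p q : Σ σ : F.cones, Chart σ.1, Relation.EqvGen (GlueRel F) p q →
      (∀ γ, Chart.mulMap m γ = p.2 →
        ∃ γ', chartMap F q.1 γ' = chartMap F p.1 γ ∧ Chart.mulMap m γ' = q.2) ∧
      (∀ γ, Chart.mulMap m γ = q.2 →
        ∃ γ', chartMap F p.1 γ' = chartMap F q.1 γ ∧ Chart.mulMap m γ' = p.2) := by
    intro p q hpq
    induction hpq with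
    | rel p q hpq =>
      obtain ⟨τ, δ⟩ := p
      obtain ⟨σ, ε⟩ := q
      obtain ⟨hface, hε⟩ := hpq
      change τ.1.IsFaceOf σ.1 at hface
      obtain rfl : ε = Chart.incl hface.le δ := hε
      have hglue : ∀ γ : Chart τ.1, chartMap F σ (Chart.incl hface.le γ) = chartMap F τ γ :=
        fun γ => (Quot.sound ⟨hface, rfl⟩).symm
      constructor
      · intro γ hγ
        exact ⟨Chart.incl hface.le γ, hglue γ, (Chart.mulMap_incl hface.le m γ).trans
          (congrArg (Chart.incl hface.le) hγ)⟩
      · intro γ (hγ : Chart.mulMap m γ = Chart.incl hface.le δ)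
        -- Choose a root `β` of `δ` in `U_τ`. Then `γ` is a torsion translate of the image of `β`,
        -- and translations preserve `U_τ`.
        obtain ⟨β, rfl⟩ := Chart.mulMap_surjective hm δ
        rw [← Chart.mulMap_incl] at hγ
        obtain ⟨t, ht, rfl⟩ := Chart.exists_torusMul_of_mulMap_eq hm hγ.symm
        exact ⟨Chart.torusMul t β, (hglue _).symm, Chart.mulMap_torusMul ht β⟩
    | refl p => exact ⟨fun γ hγ => ⟨γ, rfl, hγ⟩, fun γ hγ => ⟨γ, rfl, hγ⟩⟩
    | symm p q _ ih => exact ⟨ih.2, ih.1⟩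
    | trans p q r _ _ ih₁ ih₂ =>
      constructor
      · intro γ hγ
        obtain ⟨γ₁, h₁, h₁'⟩ := ih₁.1 γ hγ
        obtain ⟨γ₂, h₂, h₂'⟩ := ih₂.1 γ₁ h₁'
        exact ⟨γ₂, h₂.trans h₁, h₂'⟩
      · intro γ hγ
        obtain ⟨γ₁, h₁, h₁'⟩ := ih₂.2 γ hγ
        obtain ⟨γ₂, h₂, h₂'⟩ := ih₁.2 γ₁ h₁'
        exact ⟨γ₂, h₂.trans h₁, h₂'⟩
  obtain ⟨⟨σ, γ⟩, rfl⟩ := Quot.exists_rep x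
  exact (key ⟨σ, Chart.mulMap m γ⟩ ⟨τ, δ⟩ (Quot.eqvGen_exact h)).1 γ rfl

/-- Closedness is tested on charts. Since the preimage of each chart is that chart, it reduces to
properness of `Chart.mulMap`. -/
theorem isClosedMap_toricPower {n : ℕ} (F : Fan n) {m : ℕ} (hm : 0 < m) :
    IsClosedMap (toricPower F m) := by
  intro C hC
  refine isClosed_toricVariety_iff.mpr fun τ => ?_
  have : chartMap F τ ⁻¹' (toricPower F m '' C) = Chart.mulMap m '' (chartMap F τ ⁻¹' C) := by
    ext δ
    constructor
    · rintro ⟨x, hx, hxδ⟩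
      obtain ⟨γ, rfl, hγ⟩ := exists_chartMap_of_toricPower_eq hm hxδ
      exact ⟨γ, hx, hγ⟩
    · rintro ⟨γ, hγ, rfl⟩
      exact ⟨_, hγ, rfl⟩
  rw [this]
  exact (Chart.isProperMap_mulMap τ.1 hm).isClosedMap _ (hC.preimage (continuous_chartMap F τ))

/-- The fibres of `Φ_m` are orbits of the `m`-torsion of the torus. -/
theorem exists_toricMul_of_toricPower_eq {n : ℕ} {F : Fan n} {m : ℕ} (hm : 0 < m)
    {x y : ToricVariety F} (h : toricPower F m x = toricPower F m y) :
    ∃ t : Torus n, torusPower m t = 1 ∧ toricMul F t x = y := by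
  obtain ⟨⟨σ, γ⟩, rfl⟩ := Quot.exists_rep y
  obtain ⟨γ', rfl, hγ'⟩ := exists_chartMap_of_toricPower_eq (δ := Chart.mulMap m γ) hm h
  obtain ⟨t, ht, rfl⟩ := Chart.exists_torusMul_of_mulMap_eq hm hγ'
  exact ⟨t, ht, rfl⟩

end Toric

/-- The proof does not use `hZ`: `Φ_m` is a closed map whose fibres are orbits of the `m`-torsion of
the torus, so the equality holds for every subset `Z` of the torus. -/
theorem mainTheorem9 (n : ℕ) (F : Toric.Fan n) (m : ℕ) (hm : 0 < m)
    (Z : Set (Toric.Torus n)) (hZ : Toric.IsSubvariety Z) :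
    Toric.toricPower F m ⁻¹' closure (Toric.torusEmbedding F '' Z) =
      closure (Toric.torusEmbedding F '' (Toric.torusPower m ⁻¹' Z)) := by
  apply Set.Subset.antisymm
  · have hsub : closure (Toric.torusEmbedding F '' Z) ⊆ Toric.toricPower F m ''
        closure (Toric.torusEmbedding F '' (Toric.torusPower m ⁻¹' Z)) := by
      refine closure_minimal ?_ (Toric.isClosedMap_toricPower F hm _ isClosed_closure)
      rintro _ ⟨t, ht, rfl⟩
      obtain ⟨s, rfl⟩ := Toric.torusPower_surjective hm t
      exact ⟨_, subset_closure ⟨s, ht, rfl⟩, Toric.toricPower_torusEmbedding F m s⟩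
    intro x hx
    obtain ⟨y, hy, hyx⟩ := hsub hx
    obtain ⟨t, ht, rfl⟩ := Toric.exists_toricMul_of_toricPower_eq hm hyx
    refine map_mem_closure (Toric.continuous_toricMul F t) hy ?_
    rintro _ ⟨s, hs, rfl⟩
    rw [Toric.toricMul_torusEmbedding]
    refine ⟨t * s, ?_, rfl⟩
    have : Toric.torusPower m (t * s) = Toric.torusPower m t * Toric.torusPower m s :=
      mul_pow t s m
    rwa [Set.mem_preimage, this, ht, one_mul]
  · refine closure_minimal ?_ (isClosed_closure.preimage (Toric.continuous_toricPower F hm))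
    rintro _ ⟨t, ht, rfl⟩
    rw [Set.mem_preimage, Toric.toricPower_torusEmbedding]
    exact subset_closure ⟨_, ht, rfl⟩
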